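/- All locally convex spaces are real and Hausdorff. Let $E,F$ be locally convex spaces and let $U\subseteq E$ have dense interior, i.e. $U\subseteq\overline{\operatorname{int}(U)}$. A map $f\colon U\to F$ is $C^0$ if it is continuous, and $C^1$ if it is continuous, the limit $\lim_{h\to 0}\frac{1}{h}\bigl(f(x+hv)-f(x)\bigr)$ exists for all $x\in\operatorname{int}(U)$ and $v\in E$, and the resulting map $\operatorname{int}(U)\times E\to F$ extends to a continuous map $df\colon U\times E\to F$. It is $C^{n+1}$ if it is $C^1$ and $df$ is $C^n$, and smooth if it is $C^n$ for all $n\in\mathbb N_0$. Let $C^\infty(U,F)$ be the vector space of smooth maps $U\to F$, with the initial topology with respect to the maps $f\mapsto d^nf\in C(U\times E^{2^n-1},F)$, $n\in\mathbb N_0$, where $d^0f=f$, $d^{n+1}f=d(d^nf)$ and the spaces of continuous maps carry the compact-open topology. Two locally convex spaces $E$ and $E'$ satisfy the Cartesian closedness principle if for all open sets $U\subseteq E$, $U'\subseteq E'$ and every locally convex space $F$ the assignment $f\mapsto f^\wedge$, $f^\wedge(x)(y)=f(x,y)$, is a well-defined linear isomorphism $$C^\infty(U\times U',F)\to C^\infty(U,C^\infty(U',F)).$$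 **Proposition.** Suppose that $E$ and $E'$ satisfy the Cartesian closedness principle, that $U\subseteq E$ and $U'\subseteq E'$ have dense interior, and that $F$ is locally convex. Then $f\mapsto f^\wedge$, $f^\wedge(x)(y)=f(x,y)$, is a well-defined linear map $$C^\infty(U\times U',F)\to C^\infty(U,C^\infty(U',F)).$$ If, moreover, $E'$ is finite-dimensional, and $U'$ is locally compact or $E$ is metrizable, then this map is a linear isomorphism. -/

import Mathlib

open Set Filter Topology

universe u v w

noncomputable section

/-- A subset of a topological space whose interior is dense in it. -/
structure DenseIntSet (E : Type u) [TopologicalSpace E] where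
  carrier : Set E
  subset_closure_interior : carrier ⊆ closure (interior carrier)

namespace DenseIntSet

/-- An open set has dense interior. -/
def ofOpen {E : Type u} [TopologicalSpace E] (U : Set E) (hU : IsOpen U) : DenseIntSet E :=
  ⟨U, by rw [hU.interior_eq]; exact subset_closure⟩

/-- The product `U × V` inside `E × E'`. -/
def prod {E : Type u} {E' : Type v} [TopologicalSpace E] [TopologicalSpace E']
    (U : DenseIntSet E) (V : DenseIntSet E') : DenseIntSet (E × E') :=
  ⟨U.carrier ×ˢ V.carrier, by
    rw [interior_prod_eq, closure_prod_eq]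
    exact prod_mono U.subset_closure_interior V.subset_closure_interior⟩

/-- The set `U × E` inside `E × E`. -/
def tangent {E : Type u} [TopologicalSpace E] (U : DenseIntSet E) : DenseIntSet (E × E) :=
  U.prod (ofOpen univ isOpen_univ)

/-- The point `(x, y)` of `U × V`. -/
def pair {E : Type u} {E' : Type v} [TopologicalSpace E] [TopologicalSpace E']
    {U : DenseIntSet E} {V : DenseIntSet E'} (x : U.carrier) (y : V.carrier) :
    (U.prod V).carrier :=
  ⟨((x : E), (y : E')), x.2, y.2⟩

/-- The point `(x, v)` of `U × E`. -/
def tpair {E : Type u} [TopologicalSpace E] {U : DenseIntSet E} (x : U.carrier) (v : E) :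
    U.tangent.carrier :=
  ⟨((x : E), v), x.2, mem_univ v⟩

end DenseIntSet

/-- `f : U → F` is of class `C¹` with differential `df : U × E → F`: both maps are continuous and,
for `x` in the interior of `U` and every direction `v`, the limit of `(f (x + h v) - f x) / h` for
`h → 0` exists and equals `df (x, v)`. In other words, the restriction of `f` to the interior is
`C¹`, and `df` is a continuous extension to `U × E` of the differential of that restriction.
The difference quotient uses the extension of `f` by zero, whose values outside `U` do not
influence the limit because `x` is an interior point. -/
def IsC1With {E : Type u} [AddCommGroup E] [Module ℝ E] [TopologicalSpace E]
    {F : Type v} [AddCommGroup F] [Module ℝ F] [TopologicalSpace F]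
    (U : DenseIntSet E) (f : U.carrier → F) (df : U.tangent.carrier → F) : Prop :=
  Continuous f ∧ Continuous df ∧
    ∀ x : U.carrier, (x : E) ∈ interior U.carrier → ∀ v : E,
      Tendsto (fun h : ℝ => h⁻¹ • (Function.extend Subtype.val f 0 ((x : E) + h • v) - f x))
        (𝓝[≠] 0) (𝓝 (df (DenseIntSet.tpair x v)))

/-- `f : U → F` is of class `C^n`: for `n = 0` it is continuous, and it is `C^(n+1)` if it is `C¹`
and its differential `df : U × E → F` is `C^n`. -/
def IsCn {F : Type v} [AddCommGroup F] [Module ℝ F] [TopologicalSpace F] :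
    (n : ℕ) → {E : Type u} → [AddCommGroup E] → [Module ℝ E] → [TopologicalSpace E] →
      (U : DenseIntSet E) → (U.carrier → F) → Prop
  | 0, _, _, _, _, _, f => Continuous f
  | n + 1, _, _, _, _, U, f => ∃ df, IsC1With U f df ∧ IsCn n U.tangent df

/-- `f : U → F` is smooth, that is, of class `C^n` for every `n`. -/
def IsSmooth {E : Type u} [AddCommGroup E] [Module ℝ E] [TopologicalSpace E]
    {F : Type v} [AddCommGroup F] [Module ℝ F] [TopologicalSpace F]
    (U : DenseIntSet E) (f : U.carrier → F) : Prop :=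
  ∀ n : ℕ, IsCn n U f

section Linear

variable {E : Type u} [AddCommGroup E] [Module ℝ E] [TopologicalSpace E]
  {F : Type v} [AddCommGroup F] [Module ℝ F] [TopologicalSpace F]

theorem extend_eq_of_mem (U : DenseIntSet E) (f : U.carrier → F) {y : E} (hy : y ∈ U.carrier) :
    Function.extend Subtype.val f 0 y = f ⟨y, hy⟩ :=
  Subtype.val_injective.extend_apply f 0 ⟨y, hy⟩

theorem extend_add (U : DenseIntSet E) (f g : U.carrier → F) (y : E) :
    Function.extend Subtype.val (f + g) 0 y =
      Function.extend Subtype.val f 0 y + Function.extend Subtype.val g 0 y := by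
  by_cases hy : y ∈ U.carrier
  · simp [extend_eq_of_mem U _ hy]
  · have : ¬ ∃ a : U.carrier, (a : E) = y := fun ⟨a, ha⟩ => hy (ha ▸ a.2)
    simp [Function.extend_apply' _ _ _ this]

theorem extend_smul (U : DenseIntSet E) (c : ℝ) (f : U.carrier → F) (y : E) :
    Function.extend Subtype.val (c • f) 0 y = c • Function.extend Subtype.val f 0 y := by
  by_cases hy : y ∈ U.carrier
  · simp [extend_eq_of_mem U _ hy]
  · have : ¬ ∃ a : U.carrier, (a : E) = y := fun ⟨a, ha⟩ => hy (ha ▸ a.2)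
    simp [Function.extend_apply' _ _ _ this]

variable [IsTopologicalAddGroup F] [ContinuousSMul ℝ F]

theorem IsC1With.add {U : DenseIntSet E} {f g : U.carrier → F} {df dg : U.tangent.carrier → F}
    (hf : IsC1With U f df) (hg : IsC1With U g dg) : IsC1With U (f + g) (df + dg) := by
  refine ⟨hf.1.add hg.1, hf.2.1.add hg.2.1, fun x hx v => ?_⟩
  refine ((hf.2.2 x hx v).add (hg.2.2 x hx v)).congr fun h => ?_
  rw [extend_add, Pi.add_apply, ← smul_add]
  congr 1
  abel

theorem IsC1With.smul {U : DenseIntSet E} (c : ℝ) {f : U.carrier → F}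
    {df : U.tangent.carrier → F} (hf : IsC1With U f df) : IsC1With U (c • f) (c • df) := by
  refine ⟨hf.1.const_smul c, hf.2.1.const_smul c, fun x hx v => ?_⟩
  refine ((hf.2.2 x hx v).const_smul c).congr fun h => ?_
  rw [extend_smul, Pi.smul_apply, ← smul_sub, smul_comm]

end Linear

theorem IsC1With.unique {E : Type u} [AddCommGroup E] [Module ℝ E] [TopologicalSpace E]
    {F : Type v} [AddCommGroup F] [Module ℝ F] [TopologicalSpace F] [T2Space F]
    {U : DenseIntSet E} {f : U.carrier → F} {d₁ d₂ : U.tangent.carrier → F}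
    (h₁ : IsC1With U f d₁) (h₂ : IsC1With U f d₂) : d₁ = d₂ := by
  have hd : Dense {p : U.tangent.carrier | (p : E × E).1 ∈ interior U.carrier} := by
    rw [Subtype.dense_iff]
    intro p hp
    have h := U.tangent.subset_closure_interior hp
    refine closure_mono ?_ h
    intro q hq
    refine ⟨⟨q, interior_subset hq⟩, ?_, rfl⟩
    have h' : q ∈ interior (U.carrier ×ˢ (univ : Set E)) := hq
    rw [interior_prod_eq] at h'
    exact h'.1
  refine Continuous.ext_on hd h₁.2.1 h₂.2.1 ?_
  intro p hp
  exact tendsto_nhds_unique (h₁.2.2 ⟨(p : E × E).1, p.2.1⟩ hp (p : E × E).2)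
    (h₂.2.2 ⟨(p : E × E).1, p.2.1⟩ hp (p : E × E).2)

theorem IsCn.zero_fun {F : Type v} [AddCommGroup F] [Module ℝ F] [TopologicalSpace F] (n : ℕ) :
    ∀ {E : Type u} [AddCommGroup E] [Module ℝ E] [TopologicalSpace E] (U : DenseIntSet E),
      IsCn n U (0 : U.carrier → F) := by
  induction n with
  | zero => intro E _ _ _ U; exact continuous_const
  | succ n ih =>
    intro E _ _ _ U
    refine ⟨0, ⟨continuous_const, continuous_const, fun x _ v => ?_⟩, ih _⟩
    have h0 : Function.extend (Subtype.val : U.carrier → E) (0 : U.carrier → F) 0 = 0 :=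
      Function.extend_zero _
    simp only [h0, Pi.zero_apply, sub_self, smul_zero]
    exact tendsto_const_nhds

theorem IsCn.add {F : Type v} [AddCommGroup F] [Module ℝ F] [TopologicalSpace F]
    [IsTopologicalAddGroup F] [ContinuousSMul ℝ F] (n : ℕ) :
    ∀ {E : Type u} [AddCommGroup E] [Module ℝ E] [TopologicalSpace E] (U : DenseIntSet E)
      (f g : U.carrier → F), IsCn n U f → IsCn n U g → IsCn n U (f + g) := by
  induction n with
  | zero => intro E _ _ _ U f g hf hg; exact Continuous.add hf hg
  | succ n ih =>
    rintro E _ _ _ U f g ⟨df, hf, hf'⟩ ⟨dg, hg, hg'⟩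
    exact ⟨df + dg, hf.add hg, ih _ _ _ hf' hg'⟩

theorem IsCn.smul {F : Type v} [AddCommGroup F] [Module ℝ F] [TopologicalSpace F]
    [IsTopologicalAddGroup F] [ContinuousSMul ℝ F] (n : ℕ) (c : ℝ) :
    ∀ {E : Type u} [AddCommGroup E] [Module ℝ E] [TopologicalSpace E] (U : DenseIntSet E)
      (f : U.carrier → F), IsCn n U f → IsCn n U (c • f) := by
  induction n with
  | zero => intro E _ _ _ U f hf; exact Continuous.const_smul hf c
  | succ n ih =>
    rintro E _ _ _ U f ⟨df, hf, hf'⟩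
    exact ⟨c • df, hf.smul c, ih _ _ hf'⟩

/-- The smooth maps `U → F` as a linear subspace of all maps. -/
def smoothSubmodule {E : Type u} [AddCommGroup E] [Module ℝ E] [TopologicalSpace E]
    (U : DenseIntSet E) (F : Type v) [AddCommGroup F] [Module ℝ F] [TopologicalSpace F]
    [IsTopologicalAddGroup F] [ContinuousSMul ℝ F] : Submodule ℝ (U.carrier → F) where
  carrier := {f | IsSmooth U f}
  zero_mem' := fun n => IsCn.zero_fun n U
  add_mem' := fun hf hg n => IsCn.add n U _ _ (hf n) (hg n)
  smul_mem' := fun c _ hf n => IsCn.smul n c U _ (hf n)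

/-- The vector space `C^∞(U, F)` of smooth maps. This is a type of its own, so that it does not
carry the topology of pointwise convergence. -/
def SmoothMap {E : Type u} [AddCommGroup E] [Module ℝ E] [TopologicalSpace E]
    (U : DenseIntSet E) (F : Type v) [AddCommGroup F] [Module ℝ F] [TopologicalSpace F]
    [IsTopologicalAddGroup F] [ContinuousSMul ℝ F] : Type (max u v) :=
  ↥(smoothSubmodule U F)

namespace SmoothMap

variable {E : Type u} [AddCommGroup E] [Module ℝ E] [TopologicalSpace E] {U : DenseIntSet E}
  {F : Type v} [AddCommGroup F] [Module ℝ F] [TopologicalSpace F]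
  [IsTopologicalAddGroup F] [ContinuousSMul ℝ F]

instance : AddCommGroup (SmoothMap U F) := inferInstanceAs (AddCommGroup ↥(smoothSubmodule U F))

instance : Module ℝ (SmoothMap U F) := inferInstanceAs (Module ℝ ↥(smoothSubmodule U F))

instance : CoeFun (SmoothMap U F) (fun _ => U.carrier → F) := ⟨fun f => f.1⟩

theorem smooth (f : SmoothMap U F) : IsSmooth U f := f.2

/-- The inclusion of `C^∞(U, F)` into the space `C(U, F)` with the compact-open topology. -/
def toContinuous : SmoothMap U F →ₗ[ℝ] C(U.carrier, F) where
  toFun f := ⟨f, f.smooth 0⟩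
  map_add' _ _ := rfl
  map_smul' _ _ := rfl

theorem exists_differential [T2Space F] (f : SmoothMap U F) :
    ∃ df : SmoothMap U.tangent F, IsC1With U f df := by
  obtain ⟨df, h, -⟩ := f.smooth 1
  refine ⟨⟨df, fun n => ?_⟩, h⟩
  obtain ⟨dg, h', hn⟩ := f.smooth (n + 1)
  rwa [h.unique h']

/-- The differential `d : C^∞(U, F) → C^∞(U × E, F)`. -/
def differential [T2Space F] : SmoothMap U F →ₗ[ℝ] SmoothMap U.tangent F where
  toFun f := f.exists_differential.choose
  map_add' f g := Subtype.ext <| (f + g).exists_differential.choose_spec.unique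
    (f.exists_differential.choose_spec.add g.exists_differential.choose_spec)
  map_smul' c f := Subtype.ext <| (c • f).exists_differential.choose_spec.unique
    (f.exists_differential.choose_spec.smul c)

theorem differential_spec [T2Space F] (f : SmoothMap U F) :
    IsC1With U f (differential f) := f.exists_differential.choose_spec

end SmoothMap

/-- The topology on `C^∞(U, F)` induced by the single map
`f ↦ d^n f ∈ C(U × E^(2^n - 1), F)`, where the target has the compact-open topology. -/
@[reducible]
def smoothTopology {F : Type v} [AddCommGroup F] [Module ℝ F] [TopologicalSpace F]
    [IsTopologicalAddGroup F] [ContinuousSMul ℝ F] [T2Space F] :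
    (n : ℕ) → {E : Type u} → [AddCommGroup E] → [Module ℝ E] → [TopologicalSpace E] →
      (U : DenseIntSet E) → TopologicalSpace (SmoothMap U F)
  | 0, _, _, _, _, _ => TopologicalSpace.induced SmoothMap.toContinuous inferInstance
  | n + 1, _, _, _, _, U => TopologicalSpace.induced SmoothMap.differential
      (smoothTopology n U.tangent)

/-- The topology on `C^∞(U, F)`: the initial topology with respect to all the maps
`f ↦ d^n f ∈ C(U × E^(2^n - 1), F)`, where the targets have the compact-open topology. -/
instance SmoothMap.instTopologicalSpace
    {E : Type u} [AddCommGroup E] [Module ℝ E] [TopologicalSpace E] {U : DenseIntSet E}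
    {F : Type v} [AddCommGroup F] [Module ℝ F] [TopologicalSpace F]
    [IsTopologicalAddGroup F] [ContinuousSMul ℝ F] [T2Space F] :
    TopologicalSpace (SmoothMap U F) :=
  ⨅ n : ℕ, smoothTopology n U

theorem smoothTopology_isTopologicalAddGroup {F : Type v} [AddCommGroup F] [Module ℝ F]
    [TopologicalSpace F] [IsTopologicalAddGroup F] [ContinuousSMul ℝ F] [T2Space F] (n : ℕ) :
    ∀ {E : Type u} [AddCommGroup E] [Module ℝ E] [TopologicalSpace E] (U : DenseIntSet E),
      @IsTopologicalAddGroup (SmoothMap U F) (smoothTopology n U) _ := by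
  induction n with
  | zero => intro E _ _ _ U; exact topologicalAddGroup_induced SmoothMap.toContinuous
  | succ n ih =>
    intro E _ _ _ U
    let := smoothTopology (F := F) n U.tangent
    have := ih U.tangent
    exact topologicalAddGroup_induced SmoothMap.differential

theorem smoothTopology_continuousSMul {F : Type v} [AddCommGroup F] [Module ℝ F]
    [TopologicalSpace F] [IsTopologicalAddGroup F] [ContinuousSMul ℝ F] [T2Space F] (n : ℕ) :
    ∀ {E : Type u} [AddCommGroup E] [Module ℝ E] [TopologicalSpace E] (U : DenseIntSet E),
      @ContinuousSMul ℝ (SmoothMap U F) _ _ (smoothTopology n U) := by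
  induction n with
  | zero => intro E _ _ _ U; exact continuousSMul_induced SmoothMap.toContinuous
  | succ n ih =>
    intro E _ _ _ U
    let := smoothTopology (F := F) n U.tangent
    have := ih U.tangent
    exact continuousSMul_induced SmoothMap.differential

namespace SmoothMap

variable {E : Type u} [AddCommGroup E] [Module ℝ E] [TopologicalSpace E] {U : DenseIntSet E}
  {F : Type v} [AddCommGroup F] [Module ℝ F] [TopologicalSpace F]
  [IsTopologicalAddGroup F] [ContinuousSMul ℝ F] [T2Space F]

instance instIsTopologicalAddGroup : IsTopologicalAddGroup (SmoothMap U F) :=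
  topologicalAddGroup_iInf fun n => smoothTopology_isTopologicalAddGroup n U

instance instContinuousSMul : ContinuousSMul ℝ (SmoothMap U F) :=
  continuousSMul_iInf fun n => smoothTopology_continuousSMul n U

end SmoothMap

/-- The linear map `Φ` is the canonical map `f ↦ f^∧`, `f^∧(x)(y) = f(x, y)`. -/
def IsCurrying {E : Type u} [AddCommGroup E] [Module ℝ E] [TopologicalSpace E]
    {E' : Type v} [AddCommGroup E'] [Module ℝ E'] [TopologicalSpace E']
    {F : Type w} [AddCommGroup F] [Module ℝ F] [TopologicalSpace F]
    [IsTopologicalAddGroup F] [ContinuousSMul ℝ F] [T2Space F]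
    {U : DenseIntSet E} {U' : DenseIntSet E'}
    (Φ : SmoothMap (U.prod U') F →ₗ[ℝ] SmoothMap U (SmoothMap U' F)) : Prop :=
  ∀ (f : SmoothMap (U.prod U') F) (x : U.carrier) (y : U'.carrier),
    Φ f x y = f (DenseIntSet.pair x y)

/-- The Cartesian closedness principle for `E` and `E'`: for all open `U ⊆ E` and `U' ⊆ E'` and
every (Hausdorff) locally convex space `F`, the rule `f^∧(x)(y) = f(x, y)` gives a well-defined
linear isomorphism from `C^∞(U × U', F)` onto `C^∞(U, C^∞(U', F))`. -/
def CartesianClosedness (E : Type u) [AddCommGroup E] [Module ℝ E] [TopologicalSpace E]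
    (E' : Type v) [AddCommGroup E'] [Module ℝ E'] [TopologicalSpace E'] : Prop :=
  ∀ (U : Set E) (hU : IsOpen U) (U' : Set E') (hU' : IsOpen U')
    (F : Type w) [AddCommGroup F] [Module ℝ F] [TopologicalSpace F]
    [IsTopologicalAddGroup F] [ContinuousSMul ℝ F] [LocallyConvexSpace ℝ F] [T2Space F],
    ∃ Φ : SmoothMap ((DenseIntSet.ofOpen U hU).prod (DenseIntSet.ofOpen U' hU')) F →ₗ[ℝ]
        SmoothMap (DenseIntSet.ofOpen U hU) (SmoothMap (DenseIntSet.ofOpen U' hU') F),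
      IsCurrying Φ ∧ Function.Bijective Φ

end

/-!
The key is a mean value theorem: by Hahn–Banach, a difference quotient of a `C¹` map lies in every
closed convex set which contains the differentials along the segment. Hence, if the differentials
of a family of `C¹` maps converge continuously, then the difference quotients converge uniformly
in the parameter of the family. In particular differentiation is a closed operation, so that
identities for differentials extend from the dense interior to all of `U`.

Let `f` be smooth on `U × V`. Taking `y ∈ V` as the parameter, the difference quotients of
`f^∧ : x ↦ f (x, ·)` converge to the partial differential of `f` in `x`, uniformly for `y` in
compact sets. Their differentials in `y` are difference quotients of another smooth map, the
differential of `f` regarded as a map on the product of the tangent bundles, so the same argument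
gives convergence of all higher differentials. Thus `f^∧` is `C¹`, its differential is again of the
form `k^∧`, and `f^∧` is smooth by induction.

Conversely, let `g : U → C^∞(V, F)` be smooth. If `V` is locally compact, or if convergent
sequences suffice to test continuity on `U × V`, then `(x, y) ↦ g x y` is continuous, and so are its
two partial differentials, which are of the same form. A map with continuous partial differentials
is `C¹`, and induction applies once more.
-/

section Limits

theorem tendsto_of_tendsto_prod_of_eventually_tendsto {X Y Z : Type*} [TopologicalSpace Z]
    [RegularSpace Z] {l : Filter X} [l.NeBot] {m : Filter Y} {f : Y → X → Z} {g : Y → Z} {z : Z}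
    (hf : Tendsto (fun p : Y × X => f p.1 p.2) (m ×ˢ l) (𝓝 z))
    (hg : ∀ᶠ y in m, Tendsto (f y) l (𝓝 (g y))) : Tendsto g m (𝓝 z) := by
  refine (closed_nhds_basis z).tendsto_right_iff.2 fun s hs => ?_
  filter_upwards [(hf.eventually_mem hs.1).curry, hg] with y hy hgy
  exact hs.2.mem_of_tendsto hgy hy

theorem tendsto_compactOpen_of_tendsto_prod {ι X Y : Type*} [TopologicalSpace X]
    [TopologicalSpace Y] {l : Filter ι} {f : ι → C(X, Y)} {g : C(X, Y)}
    (h : ∀ x, Tendsto (fun p : ι × X => f p.1 p.2) (l ×ˢ 𝓝 x) (𝓝 (g x))) :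
    Tendsto f l (𝓝 g) := by
  refine ContinuousMap.tendsto_nhds_compactOpen.2 fun K hK O hO hg => ?_
  have hmem : {p : ι × X | f p.1 p.2 ∈ O} ∈ l ×ˢ 𝓝ˢ K :=
    hK.mem_prod_nhdsSet_of_forall fun x hx => h x (hO.mem_nhds (hg hx))
  filter_upwards [Eventually.curry hmem] with i hi
  exact fun x hx => subset_of_mem_nhdsSet hi hx

theorem continuous_uncurry_of_sequentialSpace {X Y Z : Type*} [TopologicalSpace X]
    [TopologicalSpace Y] [TopologicalSpace Z] [SequentialSpace (X × Y)] {g : X → C(Y, Z)}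
    (hg : Continuous g) : Continuous fun p : X × Y => g p.1 p.2 := by
  refine SeqContinuous.continuous fun s p hs => ?_
  have hs₁ : Tendsto (fun n => g (s n).1) atTop (𝓝 (g p.1)) :=
    (hg.tendsto p.1).comp ((continuous_fst.tendsto p).comp hs)
  have hs₂ : Tendsto (fun n => (s n).2) atTop (𝓝 p.2) := (continuous_snd.tendsto p).comp hs
  refine tendsto_nhds.2 fun O hO hp => ?_
  obtain ⟨N, hN⟩ := eventually_atTop.1
    ((((g p.1).continuous.tendsto p.2).comp hs₂).eventually_mem (hO.mem_nhds hp))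
  have hK : IsCompact (insert p.2 (range fun n => (s (n + N)).2)) :=
    (hs₂.comp (tendsto_add_atTop_nat N)).isCompact_insert_range
  have hmaps : MapsTo (g p.1) (insert p.2 (range fun n => (s (n + N)).2)) O := by
    rintro _ (rfl | ⟨n, rfl⟩)
    · exact hp
    · exact hN _ (Nat.le_add_left N n)
  filter_upwards [ContinuousMap.tendsto_nhds_compactOpen.1 hs₁ _ hK O hO hmaps,
    eventually_ge_atTop N] with n hn hNn
  exact hn (mem_insert_of_mem _ ⟨n - N, by simp only [Nat.sub_add_cancel hNn]⟩)

theorem exists_mem_nhds_isClosed_convex_subset {F : Type*} [AddCommGroup F] [Module ℝ F]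
    [TopologicalSpace F] [IsTopologicalAddGroup F] [ContinuousSMul ℝ F] [LocallyConvexSpace ℝ F]
    {l : F} {O : Set F} (hO : O ∈ 𝓝 l) : ∃ C ∈ 𝓝 l, IsClosed C ∧ Convex ℝ C ∧ C ⊆ O := by
  obtain ⟨T, hT, hTc, hTO⟩ := exists_mem_nhds_isClosed_subset hO
  obtain ⟨S, ⟨hS, hSc⟩, hST⟩ := (LocallyConvexSpace.convex_basis (𝕜 := ℝ) l).mem_iff.1 hT
  exact ⟨closure S, mem_of_superset hS subset_closure, isClosed_closure, hSc.closure,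
    (closure_minimal hST hTc).trans hTO⟩

end Limits

namespace DenseIntSet

section Topology

variable {E : Type u} [TopologicalSpace E] {E' : Type v} [TopologicalSpace E']
  {U : DenseIntSet E} {V : DenseIntSet E'}

theorem interior_prod : interior (U.prod V).carrier = interior U.carrier ×ˢ interior V.carrier :=
  interior_prod_eq _ _

theorem mem_interior_tangent {p : E × E} :
    p ∈ interior U.tangent.carrier ↔ p.1 ∈ interior U.carrier := by
  change p ∈ interior (U.carrier ×ˢ univ) ↔ _
  simp only [interior_prod_eq, interior_univ, mem_prod, mem_univ, and_true]

theorem dense_interior (U : DenseIntSet E) :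
    Dense {x : U.carrier | (x : E) ∈ interior U.carrier} := by
  refine Subtype.dense_iff.2 fun x hx => closure_mono ?_ (U.subset_closure_interior hx)
  exact fun y hy => ⟨⟨y, interior_subset hy⟩, hy, rfl⟩

theorem continuous_pair : Continuous fun p : U.carrier × V.carrier => pair p.1 p.2 :=
  Continuous.subtype_mk (by fun_prop) _

theorem continuous_tpair : Continuous fun p : U.carrier × E => tpair p.1 p.2 :=
  Continuous.subtype_mk (by fun_prop) _

end Topology

/-- A continuous linear map between the ambient spaces of `U` and `V` which maps `U` into `V` and
the interior of `U` into the interior of `V`. These are the linear changes of variables under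
which the chain rule holds without leaving the setting of sets with dense interior. -/
structure Hom {E : Type u} [AddCommGroup E] [Module ℝ E] [TopologicalSpace E]
    {E' : Type v} [AddCommGroup E'] [Module ℝ E'] [TopologicalSpace E']
    (U : DenseIntSet E) (V : DenseIntSet E') where
  toCLM : E →L[ℝ] E'
  mapsTo : MapsTo toCLM U.carrier V.carrier
  mapsTo_interior : MapsTo toCLM (interior U.carrier) (interior V.carrier)

namespace Hom

variable {E : Type u} [AddCommGroup E] [Module ℝ E] [TopologicalSpace E]
  {E' : Type v} [AddCommGroup E'] [Module ℝ E'] [TopologicalSpace E']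
  {E₁ : Type*} [AddCommGroup E₁] [Module ℝ E₁] [TopologicalSpace E₁]
  {E₂ : Type*} [AddCommGroup E₂] [Module ℝ E₂] [TopologicalSpace E₂]
  {U : DenseIntSet E} {V : DenseIntSet E'} {U₁ : DenseIntSet E₁} {U₂ : DenseIntSet E₂}

instance : CoeFun (Hom U V) (fun _ => U.carrier → V.carrier) :=
  ⟨fun A x => ⟨A.toCLM x, A.mapsTo x.2⟩⟩

theorem continuous (A : Hom U V) : Continuous A :=
  (A.toCLM.continuous.comp continuous_subtype_val).subtype_mk _

/-- The identity of `U`. -/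
def id (U : DenseIntSet E) : Hom U U :=
  ⟨.id ℝ E, fun _ h => h, fun _ h => h⟩

/-- The product `(x, y) ↦ (A x, B y)`. -/
def prodMap (A : Hom U V) (B : Hom U₁ U₂) : Hom (U.prod U₁) (V.prod U₂) where
  toCLM := A.toCLM.prodMap B.toCLM
  mapsTo _ h := ⟨A.mapsTo h.1, B.mapsTo h.2⟩
  mapsTo_interior := by
    rw [interior_prod, interior_prod]
    exact fun _ h => ⟨A.mapsTo_interior h.1, B.mapsTo_interior h.2⟩

/-- The tangent map `(x, v) ↦ (A x, A v)`. -/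
def tangent (A : Hom U V) : Hom U.tangent V.tangent :=
  A.prodMap ⟨A.toCLM, mapsTo_univ _ _, by simp only [ofOpen, interior_univ, mapsTo_univ]⟩

/-- The projection `U × V → U`. -/
def fst (U : DenseIntSet E) (V : DenseIntSet E') : Hom (U.prod V) U where
  toCLM := .fst ℝ E E'
  mapsTo _ h := h.1
  mapsTo_interior := by
    rw [interior_prod]
    exact fun _ h => h.1

/-- The projection `U × V → V`. -/
def snd (U : DenseIntSet E) (V : DenseIntSet E') : Hom (U.prod V) V where
  toCLM := .snd ℝ E E'
  mapsTo _ h := h.2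
  mapsTo_interior := by
    rw [interior_prod]
    exact fun _ h => h.2

/-- The bundle projection `U × E → U`. -/
def proj (U : DenseIntSet E) : Hom U.tangent U :=
  fst U (ofOpen univ isOpen_univ)

/-- The exchange of factors `U × V → V × U`. -/
def swap (U : DenseIntSet E) (V : DenseIntSet E') : Hom (U.prod V) (V.prod U) where
  toCLM := ContinuousLinearEquiv.prodComm ℝ E E'
  mapsTo _ h := ⟨h.2, h.1⟩
  mapsTo_interior := by
    rw [interior_prod, interior_prod]
    exact fun _ h => ⟨h.2, h.1⟩

/-- The zero section `U → U × E`, `x ↦ (x, 0)`. -/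
def zeroSection (U : DenseIntSet E) : Hom U U.tangent where
  toCLM := .inl ℝ E E
  mapsTo _ h := ⟨h, mem_univ _⟩
  mapsTo_interior _ h := mem_interior_tangent.2 h

/-- The rearrangement `(U × E) × (V × E') → (U × V) × (E × E')`, `((x, v), y, w) ↦ ((x, y), v, w)`,
by which the tangent bundle of a product is the product of the tangent bundles. -/
def mergeTangent (U : DenseIntSet E) (V : DenseIntSet E') :
    Hom (U.tangent.prod V.tangent) (U.prod V).tangent where
  toCLM := ContinuousLinearEquiv.prodProdProdComm ℝ E E E' E'
  mapsTo _ h := ⟨⟨h.1.1, h.2.1⟩, mem_univ _⟩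
  mapsTo_interior := by
    intro p hp
    rw [interior_prod] at hp
    rw [mem_interior_tangent, interior_prod]
    exact ⟨mem_interior_tangent.1 hp.1, mem_interior_tangent.1 hp.2⟩

/-- The inverse `((x, y), v, w) ↦ ((x, v), y, w)` of `mergeTangent`. -/
def splitTangent (U : DenseIntSet E) (V : DenseIntSet E') :
    Hom (U.prod V).tangent (U.tangent.prod V.tangent) where
  toCLM := ContinuousLinearEquiv.prodProdProdComm ℝ E E' E E'
  mapsTo _ h := ⟨⟨h.1.1, mem_univ _⟩, h.1.2, mem_univ _⟩
  mapsTo_interior := by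
    intro p hp
    rw [mem_interior_tangent, interior_prod] at hp
    rw [interior_prod]
    exact ⟨mem_interior_tangent.2 hp.1, mem_interior_tangent.2 hp.2⟩

end Hom

section Line

variable {E : Type u} [AddCommGroup E] [Module ℝ E] [TopologicalSpace E]
  {E' : Type v} [AddCommGroup E'] [Module ℝ E'] [TopologicalSpace E']
  {U : DenseIntSet E} {V : DenseIntSet E'}

open Classical in
/-- The point `x + h v` of `U`, with junk value `x` when `x + h v` lies outside `U`. -/
noncomputable def line (x : U.carrier) (v : E) (h : ℝ) : U.carrier :=
  if hU : (x : E) + h • v ∈ U.carrier then ⟨(x : E) + h • v, hU⟩ else x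

theorem line_eq {x y : U.carrier} {v : E} {h : ℝ} (hy : (y : E) = x + h • v) :
    line x v h = y := by
  rw [line, dif_pos (hy ▸ y.2)]
  exact Subtype.ext hy.symm

theorem coe_line {x : U.carrier} {v : E} {h : ℝ} (hU : (x : E) + h • v ∈ U.carrier) :
    (line x v h : E) = x + h • v := by
  rw [line, dif_pos hU]

theorem line_pair {x : U.carrier} {y : V.carrier} {v : E} {w : E'} {h : ℝ}
    (hx : (x : E) + h • v ∈ U.carrier) (hy : (y : E') + h • w ∈ V.carrier) :
    line (pair x y) (v, w) h = pair (line x v h) (line y w h) := by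
  refine line_eq ?_
  simp only [pair, coe_line hx, coe_line hy, Prod.smul_mk, Prod.mk_add_mk]

theorem line_tpair_zero (x : U.carrier) (v : E) (h : ℝ) :
    line (tpair x 0) (v, 0) h = tpair (line x v h) 0 := by
  by_cases hU : (x : E) + h • v ∈ U.carrier
  · refine line_eq ?_
    simp only [tpair, coe_line hU, Prod.smul_mk, Prod.mk_add_mk, smul_zero, add_zero]
  · rw [line, line, dif_neg hU, dif_neg fun hT => hU hT.1]

variable [ContinuousAdd E] [ContinuousSMul ℝ E]

theorem eventually_add_smul_mem_interior {x : U.carrier} (hx : (x : E) ∈ interior U.carrier)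
    (v : E) : ∀ᶠ h : ℝ in 𝓝 0, (x : E) + h • v ∈ interior U.carrier := by
  have hcont : Continuous fun h : ℝ => (x : E) + h • v := by fun_prop
  refine hcont.continuousAt.eventually_mem (isOpen_interior.mem_nhds ?_)
  rwa [zero_smul, add_zero]

theorem eventually_coe_line {x : U.carrier} (hx : (x : E) ∈ interior U.carrier) (v : E) :
    ∀ᶠ h : ℝ in 𝓝 0, (line x v h : E) = x + h • v :=
  (eventually_add_smul_mem_interior hx v).mono fun _ hh => coe_line (interior_subset hh)

theorem tendsto_line {x : U.carrier} (hx : (x : E) ∈ interior U.carrier) (v : E) :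
    Tendsto (line x v) (𝓝 0) (𝓝 x) := by
  have hcont : Continuous fun h : ℝ => (x : E) + h • v := by fun_prop
  have hlim := hcont.tendsto 0
  rw [zero_smul, add_zero] at hlim
  exact tendsto_subtype_rng.2 (hlim.congr' ((eventually_coe_line hx v).mono fun _ h => h.symm))

end Line

end DenseIntSet

open DenseIntSet

section DiffQuot

variable {E : Type u} [AddCommGroup E] [Module ℝ E] [TopologicalSpace E]
  {E' : Type v} [AddCommGroup E'] [Module ℝ E'] [TopologicalSpace E']
  {F : Type w} [AddCommGroup F] [Module ℝ F]
  {F' : Type*} [AddCommGroup F'] [Module ℝ F']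
  {U : DenseIntSet E} {V : DenseIntSet E'}

/-- The difference quotient `(f (x + h v) - f x) / h`; it has the junk value `0` when `h = 0` or
when `x + h v` lies outside `U`. -/
noncomputable def diffQuot (f : U.carrier → F) (x : U.carrier) (v : E) (h : ℝ) : F :=
  h⁻¹ • (f (line x v h) - f x)

theorem map_diffQuot (L : F →ₗ[ℝ] F') (f : U.carrier → F) (x : U.carrier) (v : E) (h : ℝ) :
    L (diffQuot f x v h) = diffQuot (fun y => L (f y)) x v h := by
  simp only [diffQuot, map_smul, map_sub]

theorem diffQuot_comp (f : V.carrier → F) {a : U.carrier → V.carrier} {x : U.carrier} {v : E}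
    {w : E'} {h : ℝ} (ha : (a (line x v h) : E') = a x + h • w) :
    diffQuot (f ∘ a) x v h = diffQuot f (a x) w h := by
  simp only [diffQuot, Function.comp_apply, line_eq ha]

variable [ContinuousAdd E] [ContinuousSMul ℝ E]

theorem eventually_diffQuot_eq (f : U.carrier → F) {x : U.carrier}
    (hx : (x : E) ∈ interior U.carrier) (v : E) :
    ∀ᶠ h : ℝ in 𝓝 0, diffQuot f x v h =
      h⁻¹ • (Function.extend Subtype.val f 0 ((x : E) + h • v) - f x) := by
  filter_upwards [eventually_coe_line hx v] with h hh
  rw [diffQuot, ← hh, Subtype.val_injective.extend_apply]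

end DiffQuot

section IsC1With

variable {E : Type u} [AddCommGroup E] [Module ℝ E] [TopologicalSpace E]
  {E' : Type v} [AddCommGroup E'] [Module ℝ E'] [TopologicalSpace E']
  {F : Type w} [AddCommGroup F] [Module ℝ F] [TopologicalSpace F]
  {F' : Type*} [AddCommGroup F'] [Module ℝ F'] [TopologicalSpace F']
  {U : DenseIntSet E} {V : DenseIntSet E'}

variable [ContinuousAdd E] [ContinuousSMul ℝ E]

theorem isC1With_iff_tendsto_diffQuot {f : U.carrier → F} {df : U.tangent.carrier → F} :
    IsC1With U f df ↔ Continuous f ∧ Continuous df ∧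
      ∀ x : U.carrier, (x : E) ∈ interior U.carrier → ∀ v : E,
        Tendsto (diffQuot f x v) (𝓝[≠] 0) (𝓝 (df (tpair x v))) :=
  and_congr_right' <| and_congr_right' <| forall₃_congr fun _ hx v =>
    (tendsto_congr' ((eventually_diffQuot_eq f hx v).filter_mono nhdsWithin_le_nhds)).symm

namespace IsC1With

theorem tendsto_diffQuot {f : U.carrier → F} {df : U.tangent.carrier → F}
    (hf : IsC1With U f df) {x : U.carrier} (hx : (x : E) ∈ interior U.carrier) (v : E) :
    Tendsto (diffQuot f x v) (𝓝[≠] 0) (𝓝 (df (tpair x v))) :=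
  (isC1With_iff_tendsto_diffQuot.1 hf).2.2 x hx v

theorem map {f : U.carrier → F} {df : U.tangent.carrier → F} (hf : IsC1With U f df)
    (L : F →L[ℝ] F') : IsC1With U (L ∘ f) (L ∘ df) := by
  refine isC1With_iff_tendsto_diffQuot.2
    ⟨L.continuous.comp hf.1, L.continuous.comp hf.2.1, fun x hx v => ?_⟩
  exact ((L.continuous.tendsto _).comp (hf.tendsto_diffQuot hx v)).congr
    (map_diffQuot (L : F →ₗ[ℝ] F') f x v)

theorem comp [ContinuousAdd E'] [ContinuousSMul ℝ E'] {f : V.carrier → F}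
    {df : V.tangent.carrier → F} (hf : IsC1With V f df) (A : Hom U V) :
    IsC1With U (f ∘ A) (df ∘ A.tangent) := by
  refine isC1With_iff_tendsto_diffQuot.2
    ⟨hf.1.comp A.continuous, hf.2.1.comp A.tangent.continuous, fun x hx v => ?_⟩
  refine (hf.tendsto_diffQuot (x := A x) (A.mapsTo_interior hx) (A.toCLM v)).congr' ?_
  filter_upwards [(eventually_coe_line hx v).filter_mono nhdsWithin_le_nhds] with h hh
  refine (diffQuot_comp (x := x) f (a := fun z => A z) ?_).symm
  simp only [hh, map_add, map_smul]

theorem hasDerivAt_line {f : U.carrier → ℝ} {df : U.tangent.carrier → ℝ} (hf : IsC1With U f df)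
    {x : U.carrier} {v : E} {s : ℝ} (hs : (x : E) + s • v ∈ interior U.carrier) :
    HasDerivAt (fun t => f (line x v t)) (df (tpair (line x v s) v)) s := by
  have hline : (line x v s : E) = x + s • v := coe_line (interior_subset hs)
  have hs' : (line x v s : E) ∈ interior U.carrier := hline ▸ hs
  refine hasDerivAt_iff_tendsto_slope_zero.2 ((hf.tendsto_diffQuot hs' v).congr' ?_)
  filter_upwards [(eventually_coe_line hs' v).filter_mono nhdsWithin_le_nhds] with t ht
  have hadd : line x v (s + t) = line (line x v s) v t :=
    line_eq (by rw [ht, hline, add_smul, add_assoc])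
  rw [diffQuot, hadd]

section LocallyConvex

variable [IsTopologicalAddGroup F] [ContinuousSMul ℝ F] [LocallyConvexSpace ℝ F]

/-- By Hahn–Banach it suffices to bound `φ (diffQuot f x v h)` for continuous functionals `φ`, and
there the one-dimensional mean value theorem applies. -/
theorem diffQuot_mem_of_isClosed_of_convex {f : U.carrier → F} {df : U.tangent.carrier → F}
    (hf : IsC1With U f df) {x : U.carrier} {v : E} {h : ℝ} (hh : h ≠ 0) {C : Set F}
    (hC : IsClosed C) (hCc : Convex ℝ C)
    (hU : ∀ s ∈ uIcc 0 h, (x : E) + s • v ∈ interior U.carrier)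
    (hdf : ∀ s ∈ uIcc 0 h, df (tpair (line x v s) v) ∈ C) : diffQuot f x v h ∈ C := by
  by_contra hmem
  obtain ⟨φ, u, hφC, hφ⟩ := geometric_hahn_banach_closed_point hCc hC hmem
  obtain ⟨s, hs, hmvt⟩ := domain_mvt
    (fun s hs => ((hf.map φ).hasDerivAt_line (hU s hs)).hasDerivWithinAt.hasFDerivWithinAt)
    (convex_uIcc 0 h) left_mem_uIcc right_mem_uIcc
  rw [segment_eq_uIcc] at hs
  have hline : line x v 0 = x := line_eq (by rw [zero_smul, add_zero])
  have hquot : φ (diffQuot f x v h) = φ (df (tpair (line x v s) v)) := by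
    simp only [Function.comp_apply, hline, sub_zero,
      ContinuousLinearMap.toSpanSingleton_apply, smul_eq_mul] at hmvt
    rw [diffQuot, map_smul, map_sub, hmvt, smul_eq_mul, inv_mul_cancel_left₀ hh]
  exact (hφC _ (hdf s hs)).not_gt (hquot ▸ hφ)

theorem tendsto_diffQuot_prod {ι : Type*} {m : Filter ι} {f : ι → U.carrier → F}
    {df : ι → U.tangent.carrier → F} (hf : ∀ᶠ i in m, IsC1With U (f i) (df i)) {x : U.carrier}
    (hx : (x : E) ∈ interior U.carrier) {v : E} {l : F}
    (hdf : Tendsto (fun p : ι × U.tangent.carrier => df p.1 p.2) (m ×ˢ 𝓝 (tpair x v)) (𝓝 l)) :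
    Tendsto (fun p : ℝ × ι => diffQuot (f p.2) x v p.1) (𝓝[≠] 0 ×ˢ m) (𝓝 l) := by
  refine tendsto_def.2 fun O hO => ?_
  obtain ⟨C, hCl, hC, hCc, hCO⟩ := exists_mem_nhds_isClosed_convex_subset hO
  have hcurve : Tendsto (fun s : ℝ => tpair (line x v s) v) (𝓝 0) (𝓝 (tpair x v)) :=
    (continuous_tpair.tendsto (x, v)).comp ((tendsto_line hx v).prodMk_nhds tendsto_const_nhds)
  obtain ⟨P, hP, Q, hQ, hPQ⟩ := eventually_prod_iff.1
    ((hdf.comp (tendsto_id.prodMap hcurve)).eventually_mem hCl)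
  have huIcc : ∀ᶠ h : ℝ in 𝓝 0, ∀ s ∈ uIcc 0 h, (x : E) + s • v ∈ interior U.carrier ∧ Q s :=
    (tendsto_const_nhds.uIcc tendsto_id).eventually
      ((eventually_add_smul_mem_interior hx v).and hQ).smallSets
  have hne : ∀ᶠ h : ℝ in 𝓝[≠] 0, h ≠ 0 := self_mem_nhdsWithin
  filter_upwards [(hne.and (huIcc.filter_mono nhdsWithin_le_nhds)).prod_mk (hf.and hP)]
    with p ⟨⟨hp, hs⟩, hfp, hPp⟩
  exact hCO (hfp.diffQuot_mem_of_isClosed_of_convex hp hC hCc (fun s h => (hs s h).1)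
    fun s h => hPQ hPp (hs s h).2)

/-- The mean value theorem makes the difference quotients converge uniformly along `m`, so that the
two limits `h → 0` and `m` may be interchanged. -/
theorem of_tendsto {ι : Type*} {m : Filter ι} [m.NeBot] {f : ι → U.carrier → F}
    {df : ι → U.tangent.carrier → F} {g : U.carrier → F} {dg : U.tangent.carrier → F}
    (hf : ∀ᶠ i in m, IsC1With U (f i) (df i)) (hfg : ∀ x, Tendsto (fun i => f i x) m (𝓝 (g x)))
    (hdfg : ∀ q, Tendsto (fun p : ι × U.tangent.carrier => df p.1 p.2) (m ×ˢ 𝓝 q) (𝓝 (dg q)))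
    (hg : Continuous g) (hdg : Continuous dg) : IsC1With U g dg := by
  refine isC1With_iff_tendsto_diffQuot.2 ⟨hg, hdg, fun x hx v => ?_⟩
  refine tendsto_of_tendsto_prod_of_eventually_tendsto (f := fun h i => diffQuot (f i) x v h)
    (tendsto_diffQuot_prod hf hx (hdfg (tpair x v))) (Eventually.of_forall fun h => ?_)
  exact ((hfg _).sub (hfg x)).const_smul h⁻¹

variable [ContinuousAdd E'] [ContinuousSMul ℝ E']

/-- At points `x` of the interior this is the chain rule; since the interior is dense, `of_tendsto`
extends it to all of `U`. -/
theorem partial_snd {f : (U.prod V).carrier → F} {df : (U.prod V).tangent.carrier → F}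
    (hf : IsC1With (U.prod V) f df) (x : U.carrier) :
    IsC1With V (fun y => f (pair x y))
      (fun q => df (Hom.mergeTangent U V (pair (tpair x 0) q))) := by
  have hcont : Continuous fun p : U.carrier × V.tangent.carrier =>
      df (Hom.mergeTangent U V (pair (tpair p.1 0) p.2)) :=
    hf.2.1.comp <| (Hom.mergeTangent U V).continuous.comp <| continuous_pair.comp <|
      (continuous_tpair.comp (continuous_fst.prodMk continuous_const)).prodMk continuous_snd
  have hfcont : Continuous fun p : U.carrier × V.carrier => f (pair p.1 p.2) :=
    hf.1.comp continuous_pair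
  have hint : ∀ z : U.carrier, (z : E) ∈ interior U.carrier → IsC1With V (fun y => f (pair z y))
      (fun q => df (Hom.mergeTangent U V (pair (tpair z 0) q))) := fun z hz => by
    refine isC1With_iff_tendsto_diffQuot.2 ⟨hfcont.comp (Continuous.prodMk_right z),
      hcont.comp (Continuous.prodMk_right z), fun y hy w => ?_⟩
    have hzy : ((z : E), (y : E')) ∈ interior (U.prod V).carrier := by
      rw [interior_prod]
      exact ⟨hz, hy⟩
    refine (hf.tendsto_diffQuot (x := pair z y) hzy (0, w)).congr' ?_
    filter_upwards [(eventually_coe_line hy w).filter_mono nhdsWithin_le_nhds] with h hh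
    refine (diffQuot_comp f (a := pair z) ?_).symm
    simp only [pair, hh, Prod.smul_mk, Prod.mk_add_mk, smul_zero, add_zero]
  have := mem_closure_iff_nhdsWithin_neBot.1 (U.dense_interior x)
  refine of_tendsto (m := 𝓝[{z : U.carrier | (z : E) ∈ interior U.carrier}] x)
    (eventually_nhdsWithin_of_forall hint) (fun y => ?_) (fun q => ?_)
    (hfcont.comp (.prodMk_right x)) (hcont.comp (.prodMk_right x))
  · exact (hfcont.comp (Continuous.prodMk_left y)).continuousWithinAt
  · exact (hcont.tendsto (x, q)).mono_left
      (by rw [nhds_prod_eq]; exact prod_mono_left _ nhdsWithin_le_nhds)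

theorem partial_fst {f : (U.prod V).carrier → F} {df : (U.prod V).tangent.carrier → F}
    (hf : IsC1With (U.prod V) f df) (y : V.carrier) :
    IsC1With U (fun x => f (pair x y))
      (fun q => df (Hom.mergeTangent U V (pair q (tpair y 0)))) :=
  (hf.comp (Hom.swap V U)).partial_snd y

/-- The increment of `f` from `(x, y)` to `(x + h v, y + h w)` is split at `(x, y + h w)`. Since
the base point `y + h w` of the first part moves with `h`, its limit is taken along all `y'` near
`y`. -/
theorem of_partial {f : (U.prod V).carrier → F} {d₁ : (U.tangent.prod V).carrier → F}
    {d₂ : (U.prod V.tangent).carrier → F} (hf : Continuous f) (hd₁ : Continuous d₁)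
    (hd₂ : Continuous d₂)
    (h₁ : ∀ y, IsC1With U (fun x => f (pair x y)) (fun q => d₁ (pair q y)))
    (h₂ : ∀ x, IsC1With V (fun y => f (pair x y)) (fun q => d₂ (pair x q))) :
    IsC1With (U.prod V) f
      (d₁ ∘ (Hom.id U.tangent).prodMap (Hom.proj V) ∘ Hom.splitTangent U V +
        d₂ ∘ (Hom.proj U).prodMap (Hom.id V.tangent) ∘ Hom.splitTangent U V) := by
  refine isC1With_iff_tendsto_diffQuot.2 ⟨hf, ?_, fun p hp vw => ?_⟩
  · exact (hd₁.comp ((Hom.continuous _).comp (Hom.continuous _))).add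
      (hd₂.comp ((Hom.continuous _).comp (Hom.continuous _)))
  obtain ⟨⟨x, y⟩, hxU, hyV⟩ := p
  lift x to U.carrier using hxU
  lift y to V.carrier using hyV
  obtain ⟨v, w⟩ := vw
  rw [interior_prod] at hp
  obtain ⟨hx : (x : E) ∈ interior U.carrier, hy : (y : E') ∈ interior V.carrier⟩ := hp
  have hd₁y : Tendsto (fun p : V.carrier × U.tangent.carrier => d₁ (pair p.2 p.1))
      (𝓝 y ×ˢ 𝓝 (tpair x v)) (𝓝 (d₁ (pair (tpair x v) y))) := by
    rw [← nhds_prod_eq]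
    exact (hd₁.comp (continuous_pair.comp continuous_swap)).tendsto (y, tpair x v)
  have hfst : Tendsto (fun h => diffQuot (fun x => f (pair x (line y w h))) x v h) (𝓝[≠] 0)
      (𝓝 (d₁ (pair (tpair x v) y))) :=
    (tendsto_diffQuot_prod (Eventually.of_forall h₁) hx hd₁y).comp
      (tendsto_id.prodMk ((tendsto_line hy w).mono_left nhdsWithin_le_nhds))
  refine (hfst.add ((h₂ x).tendsto_diffQuot hy w)).congr' ?_
  filter_upwards [(eventually_add_smul_mem_interior hx v).filter_mono nhdsWithin_le_nhds,
    (eventually_add_smul_mem_interior hy w).filter_mono nhdsWithin_le_nhds] with h hxh hyh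
  change _ = diffQuot f (pair x y) (v, w) h
  simp only [diffQuot, line_pair (interior_subset hxh) (interior_subset hyh), ← smul_add,
    sub_add_sub_cancel]

end LocallyConvex

end IsC1With

end IsC1With

namespace IsCn

variable {F : Type w} [AddCommGroup F] [Module ℝ F] [TopologicalSpace F]

theorem comp (n : ℕ) : ∀ {E : Type u} [AddCommGroup E] [Module ℝ E] [TopologicalSpace E]
    [ContinuousAdd E] [ContinuousSMul ℝ E] {E' : Type v} [AddCommGroup E'] [Module ℝ E']
    [TopologicalSpace E'] [ContinuousAdd E'] [ContinuousSMul ℝ E'] {U : DenseIntSet E}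
    {V : DenseIntSet E'} {f : V.carrier → F}, IsCn n V f → ∀ A : Hom U V, IsCn n U (f ∘ A) := by
  induction n with
  | zero =>
    intro E _ _ _ _ _ E' _ _ _ _ _ U V f hf A
    exact Continuous.comp hf A.continuous
  | succ n ih =>
    rintro E _ _ _ _ _ E' _ _ _ _ _ U V f ⟨df, hf, hdf⟩ A
    exact ⟨df ∘ A.tangent, hf.comp A, ih hdf A.tangent⟩

theorem map {F' : Type v} [AddCommGroup F'] [Module ℝ F'] [TopologicalSpace F'] (n : ℕ)
    (L : F →L[ℝ] F') : ∀ {E : Type u} [AddCommGroup E] [Module ℝ E] [TopologicalSpace E]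
    [ContinuousAdd E] [ContinuousSMul ℝ E] {U : DenseIntSet E} {f : U.carrier → F},
    IsCn n U f → IsCn n U (L ∘ f) := by
  induction n with
  | zero =>
    intro E _ _ _ _ _ U f hf
    exact L.continuous.comp hf
  | succ n ih =>
    rintro E _ _ _ _ _ U f ⟨df, hf, hdf⟩
    exact ⟨L ∘ df, hf.map L, ih hdf⟩

theorem of_succ (n : ℕ) : ∀ {E : Type u} [AddCommGroup E] [Module ℝ E] [TopologicalSpace E]
    {U : DenseIntSet E} {f : U.carrier → F}, IsCn (n + 1) U f → IsCn n U f := by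
  induction n with
  | zero =>
    rintro E _ _ _ U f ⟨_, hf, -⟩
    exact hf.1
  | succ n ih =>
    rintro E _ _ _ U f ⟨df, hf, hdf⟩
    exact ⟨df, hf, ih hdf⟩

theorem slice [IsTopologicalAddGroup F] [ContinuousSMul ℝ F] [LocallyConvexSpace ℝ F] (n : ℕ) :
    ∀ {E : Type u} [AddCommGroup E] [Module ℝ E] [TopologicalSpace E] [ContinuousAdd E]
    [ContinuousSMul ℝ E] {E' : Type v} [AddCommGroup E'] [Module ℝ E'] [TopologicalSpace E']
    [ContinuousAdd E'] [ContinuousSMul ℝ E'] {U : DenseIntSet E} {V : DenseIntSet E'}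
    {f : (U.prod V).carrier → F}, IsCn n (U.prod V) f → ∀ x : U.carrier,
      IsCn n V (fun y => f (pair x y)) := by
  induction n with
  | zero =>
    intro E _ _ _ _ _ E' _ _ _ _ _ U V f hf x
    exact Continuous.comp hf (continuous_pair.comp (Continuous.prodMk_right x))
  | succ n ih =>
    rintro E _ _ _ _ _ E' _ _ _ _ _ U V f ⟨df, hf, hdf⟩ x
    exact ⟨_, hf.partial_snd x, ih (comp n hdf (Hom.mergeTangent U V)) (tpair x 0)⟩

end IsCn

namespace SmoothMap

section Slice

variable {E : Type u} [AddCommGroup E] [Module ℝ E] [TopologicalSpace E]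
  {E' : Type v} [AddCommGroup E'] [Module ℝ E'] [TopologicalSpace E']
  {F : Type w} [AddCommGroup F] [Module ℝ F] [TopologicalSpace F]
  [IsTopologicalAddGroup F] [ContinuousSMul ℝ F]
  {U : DenseIntSet E} {V : DenseIntSet E'}

theorem differential_eq [T2Space F] {f : SmoothMap U F} {df : SmoothMap U.tangent F}
    (h : IsC1With U f df) : differential f = df :=
  Subtype.ext (f.differential_spec.unique h)

variable [ContinuousAdd E] [ContinuousSMul ℝ E] [ContinuousAdd E'] [ContinuousSMul ℝ E']

/-- The smooth map `x ↦ f (A x)`. -/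
def comp (f : SmoothMap V F) (A : Hom U V) : SmoothMap U F :=
  ⟨f ∘ A, fun n => IsCn.comp n (f.smooth n) A⟩

/-- The differential of `f : U × V → F` as a function `((x, v), y, w) ↦ df ((x, y), v, w)` on the
product of the tangent bundles, so that it can be curried again. -/
noncomputable def differentialProd [T2Space F] (f : SmoothMap (U.prod V) F) :
    SmoothMap (U.tangent.prod V.tangent) F :=
  (differential f).comp (Hom.mergeTangent U V)

/-- The partial differential `((x, v), y) ↦ df ((x, y), v, 0)` of `f : U × V → F` in the first
variable. -/
noncomputable def partialFst [T2Space F] (f : SmoothMap (U.prod V) F) :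
    SmoothMap (U.tangent.prod V) F :=
  f.differentialProd.comp ((Hom.id U.tangent).prodMap (Hom.zeroSection V))

variable [LocallyConvexSpace ℝ F]

/-- The smooth map `f (x, ·)`. -/
def slice (f : SmoothMap (U.prod V) F) (x : U.carrier) : SmoothMap V F :=
  ⟨fun y => f (pair x y), fun n => IsCn.slice n (f.smooth n) x⟩

variable [T2Space F]

theorem differential_slice (f : SmoothMap (U.prod V) F) (x : U.carrier) :
    differential (f.slice x) = f.differentialProd.slice (tpair x 0) :=
  differential_eq (f.differential_spec.partial_snd x)

theorem differential_diffQuot_slice (f : SmoothMap (U.prod V) F) (x : U.carrier) (v : E) (h : ℝ) :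
    differential (diffQuot f.slice x v h) =
      diffQuot f.differentialProd.slice (tpair x 0) (v, 0) h := by
  simp only [diffQuot, map_smul, map_sub, differential_slice, line_tpair_zero]

theorem tendsto_diffQuot_slice_apply (f : SmoothMap (U.prod V) F) {x : U.carrier}
    (hx : (x : E) ∈ interior U.carrier) (v : E) (y : V.carrier) :
    Tendsto (fun p : ℝ × V.carrier => diffQuot f.slice x v p.1 p.2) (𝓝[≠] 0 ×ˢ 𝓝 y)
      (𝓝 (f.partialFst.slice (tpair x v) y)) := by
  have hcont : Continuous fun p : V.carrier × U.tangent.carrier => f.partialFst (pair p.2 p.1) :=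
    Continuous.comp (f.partialFst.smooth 0) (continuous_pair.comp continuous_swap)
  have hlim := hcont.tendsto (y, tpair x v)
  rw [nhds_prod_eq] at hlim
  exact IsC1With.tendsto_diffQuot_prod
    (Eventually.of_forall fun y => f.differential_spec.partial_fst y) hx hlim

/-- Schwarz's theorem: the difference quotients of `f` in the first variable converge together with
their differentials in the second variable, and `IsC1With.of_tendsto` applies. -/
theorem differential_slice_partialFst (f : SmoothMap (U.prod V) F) {x : U.carrier}
    (hx : (x : E) ∈ interior U.carrier) (v : E) :
    differential (f.partialFst.slice (tpair x v)) =
      f.differentialProd.partialFst.slice (tpair (tpair x 0) (v, 0)) := by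
  refine differential_eq (IsC1With.of_tendsto (m := 𝓝[≠] (0 : ℝ))
    (Eventually.of_forall fun h => (diffQuot f.slice x v h).differential_spec) (fun y => ?_)
    (fun q => ?_) (smooth _ 0) (smooth _ 0))
  · exact (f.tendsto_diffQuot_slice_apply hx v y).comp
      (tendsto_id.prodMk tendsto_const_nhds)
  · simp only [differential_diffQuot_slice]
    exact f.differentialProd.tendsto_diffQuot_slice_apply (mem_interior_tangent.2 hx) (v, 0) q

end Slice

section Curry

variable {F : Type w} [AddCommGroup F] [Module ℝ F] [TopologicalSpace F]
  [IsTopologicalAddGroup F] [ContinuousSMul ℝ F] [LocallyConvexSpace ℝ F] [T2Space F]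

theorem continuous_slice_smoothTopology (n : ℕ) :
    ∀ {E : Type u} [AddCommGroup E] [Module ℝ E] [TopologicalSpace E] [ContinuousAdd E]
    [ContinuousSMul ℝ E] {E' : Type v} [AddCommGroup E'] [Module ℝ E'] [TopologicalSpace E']
    [ContinuousAdd E'] [ContinuousSMul ℝ E'] {U : DenseIntSet E} {V : DenseIntSet E'}
    (f : SmoothMap (U.prod V) F), Continuous[_, smoothTopology n V] f.slice := by
  induction n with
  | zero =>
    intro E _ _ _ _ _ E' _ _ _ _ _ U V f
    exact continuous_induced_rng.2 <| ContinuousMap.continuous_of_continuous_uncurry _ <|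
      Continuous.comp (f.smooth 0) continuous_pair
  | succ n ih =>
    intro E _ _ _ _ _ E' _ _ _ _ _ U V f
    let := smoothTopology (F := F) n V.tangent
    refine continuous_induced_rng.2 (((ih f.differentialProd).comp <|
      continuous_tpair.comp <| Continuous.prodMk_left 0).congr fun x => ?_)
    exact (f.differential_slice x).symm

theorem tendsto_diffQuot_slice_smoothTopology (n : ℕ) :
    ∀ {E : Type u} [AddCommGroup E] [Module ℝ E] [TopologicalSpace E] [ContinuousAdd E]
    [ContinuousSMul ℝ E] {E' : Type v} [AddCommGroup E'] [Module ℝ E'] [TopologicalSpace E']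
    [ContinuousAdd E'] [ContinuousSMul ℝ E'] {U : DenseIntSet E} {V : DenseIntSet E'}
    (f : SmoothMap (U.prod V) F) {x : U.carrier}, (x : E) ∈ interior U.carrier → ∀ v : E,
    Tendsto (diffQuot f.slice x v) (𝓝[≠] 0)
      (@nhds _ (smoothTopology n V) (f.partialFst.slice (tpair x v))) := by
  induction n with
  | zero =>
    intro E _ _ _ _ _ E' _ _ _ _ _ U V f x hx v
    rw [nhds_induced, tendsto_comap_iff]
    exact tendsto_compactOpen_of_tendsto_prod (f.tendsto_diffQuot_slice_apply hx v)
  | succ n ih =>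
    intro E _ _ _ _ _ E' _ _ _ _ _ U V f x hx v
    let := smoothTopology (F := F) n V.tangent
    rw [nhds_induced, tendsto_comap_iff, f.differential_slice_partialFst hx v]
    exact (ih f.differentialProd (mem_interior_tangent.2 hx) (v, 0)).congr fun h =>
      (f.differential_diffQuot_slice x v h).symm

variable {E' : Type v} [AddCommGroup E'] [Module ℝ E'] [TopologicalSpace E']
  [ContinuousAdd E'] [ContinuousSMul ℝ E'] {V : DenseIntSet E'}

theorem continuous_slice {E : Type u} [AddCommGroup E] [Module ℝ E] [TopologicalSpace E]
    [ContinuousAdd E] [ContinuousSMul ℝ E] {U : DenseIntSet E} (f : SmoothMap (U.prod V) F) :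
    Continuous f.slice :=
  continuous_iInf_rng.2 fun n => continuous_slice_smoothTopology n f

theorem isC1With_slice {E : Type u} [AddCommGroup E] [Module ℝ E] [TopologicalSpace E]
    [ContinuousAdd E] [ContinuousSMul ℝ E] {U : DenseIntSet E} (f : SmoothMap (U.prod V) F) :
    IsC1With U f.slice f.partialFst.slice := by
  refine isC1With_iff_tendsto_diffQuot.2
    ⟨f.continuous_slice, f.partialFst.continuous_slice, fun x hx v => ?_⟩
  rw [nhds_iInf, tendsto_iInf]
  exact fun n => tendsto_diffQuot_slice_smoothTopology n f hx v

theorem isCn_slice (n : ℕ) : ∀ {E : Type u} [AddCommGroup E] [Module ℝ E] [TopologicalSpace E]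
    [ContinuousAdd E] [ContinuousSMul ℝ E] {U : DenseIntSet E} (f : SmoothMap (U.prod V) F),
    IsCn n U f.slice := by
  induction n with
  | zero =>
    intro E _ _ _ _ _ U f
    exact f.continuous_slice
  | succ n ih =>
    intro E _ _ _ _ _ U f
    exact ⟨_, f.isC1With_slice, ih f.partialFst⟩

/-- The canonical map `f ↦ f^∧`, `f^∧(x)(y) = f(x, y)`. -/
def curry {E : Type u} [AddCommGroup E] [Module ℝ E] [TopologicalSpace E] [ContinuousAdd E]
    [ContinuousSMul ℝ E] {U : DenseIntSet E} :
    SmoothMap (U.prod V) F →ₗ[ℝ] SmoothMap U (SmoothMap V F) where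
  toFun f := ⟨f.slice, fun n => isCn_slice n f⟩
  map_add' _ _ := rfl
  map_smul' _ _ := rfl

end Curry

end SmoothMap

namespace SmoothMap

section ContinuousLinearMap

variable {E : Type u} [AddCommGroup E] [Module ℝ E] [TopologicalSpace E] {U : DenseIntSet E}
  {F : Type v} [AddCommGroup F] [Module ℝ F] [TopologicalSpace F]
  [IsTopologicalAddGroup F] [ContinuousSMul ℝ F] [T2Space F]

theorem continuous_toContinuous :
    Continuous (toContinuous : SmoothMap U F →ₗ[ℝ] C(U.carrier, F)) :=
  continuous_iInf_dom (i := 0) continuous_induced_dom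

/-- The differential `C^∞(U, F) → C^∞(U × E, F)` as a continuous linear map. -/
noncomputable def differentialCLM : SmoothMap U F →L[ℝ] SmoothMap U.tangent F where
  toLinearMap := differential
  cont := by
    refine continuous_iInf_rng.2 fun n => continuous_iInf_dom (i := n + 1) ?_
    let := smoothTopology (F := F) n U.tangent
    exact continuous_induced_dom

/-- The evaluation `f ↦ f x` as a continuous linear map. -/
def evalCLM (x : U.carrier) : SmoothMap U F →L[ℝ] F where
  toFun f := f x
  map_add' _ _ := rfl
  map_smul' _ _ := rfl
  cont := (continuous_eval_const x).comp continuous_toContinuous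

end ContinuousLinearMap

end SmoothMap

theorem DenseIntSet.locallyCompactSpace_tangent {E : Type u} [AddCommGroup E] [Module ℝ E]
    [TopologicalSpace E] [ContinuousAdd E] [ContinuousSMul ℝ E] {U : DenseIntSet E}
    [LocallyCompactSpace U.carrier] : LocallyCompactSpace U.tangent.carrier := by
  rcases isEmpty_or_nonempty U.carrier with hU | hU
  · exact ⟨fun p => hU.elim (Hom.proj U p)⟩
  obtain ⟨x, hx : (x : E) ∈ interior U.carrier⟩ := U.dense_interior.nonempty
  obtain ⟨K, hK, hKx⟩ := exists_compact_mem_nhds x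
  have hKx' : Subtype.val '' K ∈ 𝓝 (x : E) := by
    rw [← map_nhds_subtype_coe_eq_nhds x.2 (mem_interior_iff_mem_nhds.1 hx)]
    exact image_mem_map hKx
  have : ContinuousNeg E := .of_continuousConstSMul ℝ E
  have : IsTopologicalAddGroup E := {}
  have : LocallyCompactSpace E :=
    (hK.image continuous_subtype_val).locallyCompactSpace_of_mem_nhds_of_addGroup hKx'
  have : LocallyCompactSpace (univ : Set E) :=
    isClosed_univ.isClosedEmbedding_subtypeVal.locallyCompactSpace
  exact (Homeomorph.Set.prod U.carrier univ).isClosedEmbedding.locallyCompactSpace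

namespace SmoothMap

section Uncurry

variable {F : Type w} [AddCommGroup F] [Module ℝ F] [TopologicalSpace F]
  [IsTopologicalAddGroup F] [ContinuousSMul ℝ F]

/-- The map `g^∨ (x, y) = g x y` on `U × V` associated with `g : U → C^∞(V, F)`. -/
def uncurry {E : Type u} [AddCommGroup E] [Module ℝ E] [TopologicalSpace E]
    {E' : Type v} [AddCommGroup E'] [Module ℝ E'] [TopologicalSpace E']
    {U : DenseIntSet E} {V : DenseIntSet E'} (g : U.carrier → SmoothMap V F)
    (p : (U.prod V).carrier) : F :=
  g (Hom.fst U V p) (Hom.snd U V p)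

variable [T2Space F]

theorem continuous_uncurry {E : Type u} [AddCommGroup E] [Module ℝ E] [TopologicalSpace E]
    {E' : Type v} [AddCommGroup E'] [Module ℝ E'] [TopologicalSpace E']
    {U : DenseIntSet E} {V : DenseIntSet E'}
    (h : LocallyCompactSpace V.carrier ∨ FirstCountableTopology E ∧ FirstCountableTopology E')
    {g : U.carrier → SmoothMap V F} (hg : Continuous g) : Continuous (uncurry g) := by
  have hg' : Continuous fun x => (g x).toContinuous := continuous_toContinuous.comp hg
  have hjoint : Continuous fun p : U.carrier × V.carrier => g p.1 p.2 := by
    rcases h with h | ⟨_, _⟩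
    · exact ContinuousMap.continuous_uncurry_of_continuous ⟨_, hg'⟩
    · exact continuous_uncurry_of_sequentialSpace hg'
  exact hjoint.comp ((Hom.fst U V).continuous.prodMk (Hom.snd U V).continuous)

variable [LocallyConvexSpace ℝ F]

theorem isCn_uncurry (n : ℕ) : ∀ {E : Type u} [AddCommGroup E] [Module ℝ E] [TopologicalSpace E]
    [ContinuousAdd E] [ContinuousSMul ℝ E] {E' : Type v} [AddCommGroup E'] [Module ℝ E']
    [TopologicalSpace E'] [ContinuousAdd E'] [ContinuousSMul ℝ E'] {U : DenseIntSet E}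
    {V : DenseIntSet E'},
    LocallyCompactSpace V.carrier ∨ FirstCountableTopology E ∧ FirstCountableTopology E' →
    ∀ {g : U.carrier → SmoothMap V F}, IsCn n U g → IsCn n (U.prod V) (uncurry g) := by
  induction n with
  | zero =>
    intro E _ _ _ _ _ E' _ _ _ _ _ U V h g hg
    exact continuous_uncurry h hg
  | succ n ih =>
    intro E _ _ _ _ _ E' _ _ _ _ _ U V h g hg
    have hfst : LocallyCompactSpace V.carrier ∨
        FirstCountableTopology (E × E) ∧ FirstCountableTopology E' :=
      h.imp_right fun ⟨_, _⟩ => ⟨inferInstance, inferInstance⟩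
    have hsnd : LocallyCompactSpace V.tangent.carrier ∨
        FirstCountableTopology E ∧ FirstCountableTopology (E' × E') :=
      h.imp (fun _ : LocallyCompactSpace V.carrier => locallyCompactSpace_tangent)
        fun ⟨_, _⟩ => ⟨inferInstance, inferInstance⟩
    have hgd : IsCn n U (differentialCLM ∘ g) := IsCn.map n differentialCLM (IsCn.of_succ n hg)
    obtain ⟨dg, hg, hdg⟩ := hg
    refine ⟨_, IsC1With.of_partial (continuous_uncurry h hg.1) (continuous_uncurry hfst hg.2.1)
      (continuous_uncurry hsnd (differentialCLM.continuous.comp hg.1))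
      (fun y => hg.map (evalCLM y)) (fun x => (g x).differential_spec), ?_⟩
    exact IsCn.add n _ _ _
      (IsCn.comp n (IsCn.comp n (ih hfst hdg) _) _) (IsCn.comp n (IsCn.comp n (ih hsnd hgd) _) _)

theorem curry_bijective {E : Type u} [AddCommGroup E] [Module ℝ E] [TopologicalSpace E]
    [ContinuousAdd E] [ContinuousSMul ℝ E] {E' : Type v} [AddCommGroup E'] [Module ℝ E']
    [TopologicalSpace E'] [ContinuousAdd E'] [ContinuousSMul ℝ E']
    {U : DenseIntSet E} {V : DenseIntSet E'}
    (h : LocallyCompactSpace V.carrier ∨ FirstCountableTopology E ∧ FirstCountableTopology E') :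
    Function.Bijective (curry : SmoothMap (U.prod V) F →ₗ[ℝ] SmoothMap U (SmoothMap V F)) := by
  refine ⟨fun f₁ f₂ hf => Subtype.ext (funext fun p => ?_), fun g => ?_⟩
  · exact congrArg (fun g : SmoothMap U (SmoothMap V F) => uncurry g p) hf
  · exact ⟨⟨uncurry g, fun n => isCn_uncurry n h (g.smooth n)⟩, rfl⟩

end Uncurry

end SmoothMap

theorem mainTheorem7_general
    {E : Type u} [AddCommGroup E] [Module ℝ E] [TopologicalSpace E]
    [ContinuousAdd E] [ContinuousSMul ℝ E]
    {E' : Type v} [AddCommGroup E'] [Module ℝ E'] [TopologicalSpace E']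
    [ContinuousAdd E'] [ContinuousSMul ℝ E']
    (U : DenseIntSet E) (V : DenseIntSet E')
    (F : Type w) [AddCommGroup F] [Module ℝ F] [TopologicalSpace F]
    [IsTopologicalAddGroup F] [ContinuousSMul ℝ F] [LocallyConvexSpace ℝ F] [T2Space F] :
    ∃ Φ : SmoothMap (U.prod V) F →ₗ[ℝ] SmoothMap U (SmoothMap V F),
      IsCurrying Φ ∧
        (LocallyCompactSpace V.carrier ∨ FirstCountableTopology E ∧ FirstCountableTopology E' →
          Function.Bijective Φ) :=
  ⟨SmoothMap.curry, fun _ _ _ => rfl, SmoothMap.curry_bijective⟩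

theorem mainTheorem7
    (E : Type u) [AddCommGroup E] [Module ℝ E] [TopologicalSpace E]
    [IsTopologicalAddGroup E] [ContinuousSMul ℝ E] [LocallyConvexSpace ℝ E] [T2Space E]
    (E' : Type v) [AddCommGroup E'] [Module ℝ E'] [TopologicalSpace E']
    [IsTopologicalAddGroup E'] [ContinuousSMul ℝ E'] [LocallyConvexSpace ℝ E'] [T2Space E']
    (hCCP : CartesianClosedness.{u, v, w} E E')
    (U : Set E) (hU : U ⊆ closure (interior U))
    (U' : Set E') (hU' : U' ⊆ closure (interior U'))
    (F : Type w) [AddCommGroup F] [Module ℝ F] [TopologicalSpace F]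
    [IsTopologicalAddGroup F] [ContinuousSMul ℝ F] [LocallyConvexSpace ℝ F] [T2Space F] :
    ∃ Φ : SmoothMap (DenseIntSet.prod ⟨U, hU⟩ ⟨U', hU'⟩) F →ₗ[ℝ]
        SmoothMap (⟨U, hU⟩ : DenseIntSet E) (SmoothMap (⟨U', hU'⟩ : DenseIntSet E') F),
      IsCurrying Φ ∧
        (FiniteDimensional ℝ E' → LocallyCompactSpace U' ∨ TopologicalSpace.MetrizableSpace E →
          Function.Bijective Φ) := by
  obtain ⟨Φ, hΦ, hbij⟩ := mainTheorem7_general (⟨U, hU⟩ : DenseIntSet E) ⟨U', hU'⟩ F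
  refine ⟨Φ, hΦ, fun _ h => hbij (h.imp_right fun _ : TopologicalSpace.MetrizableSpace E =>
    ⟨inferInstance, ?_⟩)⟩
  exact (toEuclidean (E := E')).toHomeomorph.isInducing.firstCountableTopology
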